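/- Let $q$ be a prime power. A line spread of $\mathrm{AG}(3,q)$ is a set of pairwise disjoint lines of $\mathrm{AG}(3,q)$ that partitions its point set; here disjoint means having no affine point in common. A Cameron-Liebler line class of parameter $x$ in $\mathrm{AG}(3,q)$ is a set $\mathcal{L}$ of lines of $\mathrm{AG}(3,q)$ such that $|\mathcal{L}\cap\mathcal{S}|=x$ for every line spread $\mathcal{S}$ of $\mathrm{AG}(3,q)$. Let $\mathcal{L}$ be a Cameron-Liebler line class of parameter $x$ in $\mathrm{AG}(3,q)$. Then, for every plane $\pi$ of $\mathrm{AG}(3,q)$, the number of lines of $\mathcal{L}$ contained in $\pi$ is $\equiv 0 \pmod{q+1}$, and, for every point $p$ of $\mathrm{AG}(3,q)$, the number of lines of $\mathcal{L}$ through $p$ is $\equiv x \pmod{q+1}$. -/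

import Mathlib

namespace CameronLiebler

/-- The points of the affine space AG(3,q) over the field `K` with q elements. -/
abbrev Point (K : Type*) : Type _ := Fin 3 → K

variable {K : Type*} [Field K]

/-- The lines of AG(3,q): nonempty affine subspaces of dimension one. -/
def IsLine (l : AffineSubspace K (Point K)) : Prop :=
  (l : Set (Point K)).Nonempty ∧ Module.finrank K l.direction = 1

/-- The planes of AG(3,q): nonempty affine subspaces of dimension two. -/
def IsPlane (π : AffineSubspace K (Point K)) : Prop :=
  (π : Set (Point K)).Nonempty ∧ Module.finrank K π.direction = 2

/-- A partial line spread: a set of lines of AG(3,q), no two of which share an affine point. -/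
def IsPartialLineSpread (S : Set (AffineSubspace K (Point K))) : Prop :=
  (∀ l ∈ S, IsLine l) ∧
    ∀ l ∈ S, ∀ m ∈ S, l ≠ m → Disjoint (l : Set (Point K)) (m : Set (Point K))

/-- A line spread: a partial line spread whose lines cover, hence partition, the point set. -/
def IsLineSpread (S : Set (AffineSubspace K (Point K))) : Prop :=
  IsPartialLineSpread S ∧ ∀ p : Point K, ∃ l ∈ S, p ∈ l

/-- A Cameron-Liebler line class of parameter `x` in AG(3,q): a set of lines that has exactly `x`
lines in common with every line spread. -/
def IsCLLineClass (L : Set (AffineSubspace K (Point K))) (x : ℕ) : Prop :=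
  (∀ l ∈ L, IsLine l) ∧
    ∀ S : Set (AffineSubspace K (Point K)), IsLineSpread S → (L ∩ S).ncard = x

/-- The set of lines through the point `p`. -/
def linesThrough (p : Point K) : Set (AffineSubspace K (Point K)) := {l | IsLine l ∧ p ∈ l}

/-- The set of lines contained in the plane `π`. -/
def linesIn (π : AffineSubspace K (Point K)) : Set (AffineSubspace K (Point K)) :=
  {l | IsLine l ∧ l ≤ π}

end CameronLiebler

namespace CameronLiebler

variable {K : Type*} [Field K]

/-! Planes. In a parallel class of lines, those inside a plane `π` can be replaced by the lines of
`π` in another direction, and the result is again a spread. So `L` has equally many lines in `π` in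
each of the `q + 1` directions of `π`.

Points. The key is `IsCLLineClass.ncard_skew`: a line `l` is skew to exactly `q² (x - [l ∈ L])`
lines of `L`. For the `z`-axis this comes from `q²` spreads through it that cover each line skew to
it exactly once; affine automorphisms carry the count to every line. Sum it over the `q + 1` lines
through `p` in a plane `π`. A line is skew to `q` of them if it avoids `p` and does not lie in `π`,
and to none otherwise. With `N` such lines in `L`, and `a` lines of `L` through `p` in `π`, this
gives `N + q a = (q + 1) q x`. Since `|L| = (q² + q + 1) x`, inclusion-exclusion leaves `x + (q + 1)
a - t` lines of `L` through `p`, where `t` counts those in `π`; by the first part `q + 1` divides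
`t`. -/

/-! ### Double counting. -/

theorem sum_ncard_sep_eq_ncard_mul {α β : Type*} [Finite α] (s : Set α) (t : Finset β)
    (r : α → β → Prop) (k : ℕ) (h : ∀ a ∈ s, {b | b ∈ t ∧ r a b}.ncard = k) :
    ∑ b ∈ t, {a | a ∈ s ∧ r a b}.ncard = s.ncard * k := by
  classical
  have := Fintype.ofFinite α
  have h1 := Finset.sum_card_bipartiteAbove_eq_sum_card_bipartiteBelow
    (s := s.toFinset) (t := t) r
  have h2 : ∑ a ∈ s.toFinset, (t.bipartiteAbove r a).card = ∑ a ∈ s.toFinset, k := by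
    refine Finset.sum_congr rfl fun a ha => ?_
    rw [← h a (by simpa using ha), ← Set.ncard_coe_finset]
    congr 1
    ext b
    simp [Finset.bipartiteAbove]
  have h3 : ∑ b ∈ t, (s.toFinset.bipartiteBelow r b).card
      = ∑ b ∈ t, {a | a ∈ s ∧ r a b}.ncard := by
    refine Finset.sum_congr rfl fun b _ => ?_
    rw [← Set.ncard_coe_finset]
    congr 1
    ext a
    simp [Finset.bipartiteBelow]
  rw [← h3, ← h1, h2, Finset.sum_const, smul_eq_mul, Set.ncard_eq_toFinset_card']

theorem ncard_sep_add_ncard_sep_not {α : Type*} [Finite α] (s : Set α) (P : α → Prop) :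
    {a | a ∈ s ∧ P a}.ncard + {a | a ∈ s ∧ ¬ P a}.ncard = s.ncard := by
  rw [← Set.ncard_union_eq]
  · congr 1
    ext a
    simp only [Set.mem_union, Set.mem_ofPred_eq]
    tauto
  · rw [Set.disjoint_left]
    rintro a ⟨_, h⟩ ⟨_, h'⟩
    exact h' h

theorem ncard_setOf_eq_one {α : Type*} {P : α → Prop} (h : ∃! a, P a) : {a | P a}.ncard = 1 := by
  obtain ⟨a, ha, hu⟩ := h
  rw [Set.ncard_eq_one]
  exact ⟨a, Set.eq_singleton_iff_unique_mem.2 ⟨ha, hu⟩⟩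

/-! ### Counting directions. -/

instance [Finite K] : Finite (AffineSubspace K (Point K)) :=
  Finite.of_injective (fun s => (s : Set (Point K))) SetLike.coe_injective

instance [Finite K] : Finite (Submodule K (Point K)) :=
  Finite.of_injective (fun s => (s : Set (Point K))) SetLike.coe_injective

/-- The one-dimensional subspaces of `W`. -/
noncomputable def directionsIn [Finite K] (W : Submodule K (Point K)) :
    Finset (Submodule K (Point K)) :=
  (Set.toFinite {δ : Submodule K (Point K) | Module.finrank K δ = 1 ∧ δ ≤ W}).toFinset

theorem mem_directionsIn [Finite K] {W δ : Submodule K (Point K)} :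
    δ ∈ directionsIn W ↔ Module.finrank K δ = 1 ∧ δ ≤ W := by
  simp [directionsIn]

theorem card_directionsIn [Finite K] (W : Submodule K (Point K)) :
    (directionsIn W).card = ∑ i ∈ Finset.range (Module.finrank K W), Nat.card K ^ i := by
  rw [← Projectivization.card_of_finrank K W rfl,
    Nat.card_congr (Projectivization.equivSubmodule K W), ← Set.ncard_coe_finset,
    ← Nat.card_coe_set_eq]
  refine Nat.card_congr (Equiv.symm ?_)
  refine Equiv.ofBijective
    (fun H => ⟨H.1.map W.subtype, ?_⟩) ⟨?_, ?_⟩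
  · rw [Finset.mem_coe, mem_directionsIn]
    refine ⟨?_, Submodule.map_subtype_le W H.1⟩
    rw [← (Submodule.equivSubtypeMap W H.1).finrank_eq, H.2]
  · rintro ⟨H, hH⟩ ⟨H', hH'⟩ h
    simp only [Subtype.mk.injEq] at h ⊢
    exact Submodule.map_injective_of_injective W.injective_subtype h
  · rintro ⟨δ, hδ⟩
    rw [Finset.mem_coe, mem_directionsIn] at hδ
    refine ⟨⟨δ.comap W.subtype, ?_⟩, ?_⟩
    · rw [← hδ.1]
      exact (Submodule.comapSubtypeEquivOfLe hδ.2).finrank_eq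
    · simp [Submodule.map_comap_subtype, hδ.2]

/-! ### Spreads built from parallel classes. -/

theorem isLine_mk' (p : Point K) {δ : Submodule K (Point K)} (hδ : Module.finrank K δ = 1) :
    IsLine (AffineSubspace.mk' p δ) :=
  ⟨⟨p, AffineSubspace.self_mem_mk' p δ⟩, by rw [AffineSubspace.direction_mk', hδ]⟩

theorem eq_of_direction_eq_of_mem {l m : AffineSubspace K (Point K)} {p : Point K}
    (h : l.direction = m.direction) (hl : p ∈ l) (hm : p ∈ m) : l = m :=
  AffineSubspace.ext_of_direction_eq h ⟨p, hl, hm⟩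

theorem isLineSpread_of_existsUnique {S : Set (AffineSubspace K (Point K))}
    (hS : ∀ l ∈ S, IsLine l) (h : ∀ p, ∃ l ∈ S, p ∈ l)
    (hu : ∀ p, ∀ l ∈ S, ∀ m ∈ S, p ∈ l → p ∈ m → l = m) : IsLineSpread S := by
  refine ⟨⟨hS, fun l hl m hm hne => ?_⟩, h⟩
  rw [Set.disjoint_left]
  exact fun p hpl hpm => hne (hu p l hl m hm hpl hpm)

theorem isLineSpread_parallel {δ : Submodule K (Point K)} (hδ : Module.finrank K δ = 1) :
    IsLineSpread {l | IsLine l ∧ l.direction = δ} := by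
  refine isLineSpread_of_existsUnique (fun l hl => hl.1) (fun p => ?_) ?_
  · exact ⟨AffineSubspace.mk' p δ, ⟨isLine_mk' p hδ, AffineSubspace.direction_mk' p δ⟩,
      AffineSubspace.self_mem_mk' p δ⟩
  · rintro p l ⟨_, hl⟩ m ⟨_, hm⟩ hpl hpm
    exact eq_of_direction_eq_of_mem (hl.trans hm.symm) hpl hpm

/-- A parallel class of lines can be switched to another parallel class inside a plane. -/
theorem isLineSpread_switch {π : AffineSubspace K (Point K)} {δ ε : Submodule K (Point K)}
    (hδ : Module.finrank K δ = 1) (hδπ : δ ≤ π.direction)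
    (hε : Module.finrank K ε = 1) (hεπ : ε ≤ π.direction) :
    IsLineSpread {l | IsLine l ∧ ((l.direction = δ ∧ ¬ l ≤ π) ∨ (l.direction = ε ∧ l ≤ π))} := by
  have key : ∀ l : AffineSubspace K (Point K), ∀ p ∈ l, p ∈ π → l.direction ≤ π.direction →
      l ≤ π := fun l p hl hp h => by
    rw [← AffineSubspace.mk'_eq hl, ← AffineSubspace.mk'_eq hp]
    intro x hx
    rw [AffineSubspace.mem_mk'] at hx ⊢
    exact h hx
  refine isLineSpread_of_existsUnique (fun l hl => hl.1) (fun p => ?_) ?_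
  · by_cases hp : p ∈ π
    · refine ⟨AffineSubspace.mk' p ε, ⟨isLine_mk' p hε, Or.inr ?_⟩,
        AffineSubspace.self_mem_mk' p ε⟩
      exact ⟨AffineSubspace.direction_mk' p ε, key _ p (AffineSubspace.self_mem_mk' p ε) hp
        (by rwa [AffineSubspace.direction_mk'])⟩
    · refine ⟨AffineSubspace.mk' p δ, ⟨isLine_mk' p hδ, Or.inl ?_⟩,
        AffineSubspace.self_mem_mk' p δ⟩
      exact ⟨AffineSubspace.direction_mk' p δ, fun h => hp (h (AffineSubspace.self_mem_mk' p δ))⟩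
  · rintro p l ⟨_, hl⟩ m ⟨_, hm⟩ hpl hpm
    rcases hl with ⟨hl, hl'⟩ | ⟨hl, hl'⟩ <;> rcases hm with ⟨hm, hm'⟩ | ⟨hm, hm'⟩
    · exact eq_of_direction_eq_of_mem (hl.trans hm.symm) hpl hpm
    · exact absurd (key l p hpl (hm' hpm) (hl ▸ hδπ)) hl'
    · exact absurd (key m p hpm (hl' hpl) (hm ▸ hδπ)) hm'
    · exact eq_of_direction_eq_of_mem (hl.trans hm.symm) hpl hpm

/-! ### The size of a class and its lines in a plane. -/

variable {L : Set (AffineSubspace K (Point K))} {x : ℕ}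

theorem IsCLLineClass.ncard_direction_eq (hL : IsCLLineClass L x) {δ : Submodule K (Point K)}
    (hδ : Module.finrank K δ = 1) : {l | l ∈ L ∧ l.direction = δ}.ncard = x := by
  rw [← hL.2 _ (isLineSpread_parallel hδ)]
  congr 1
  ext l
  exact ⟨fun h => ⟨h.1, hL.1 l h.1, h.2⟩, fun h => ⟨h.1, h.2.2⟩⟩

/-- The parallel classes are `q² + q + 1` spreads that partition all lines. -/
theorem IsCLLineClass.ncard_eq [Finite K] (hL : IsCLLineClass L x) :
    L.ncard = (Nat.card K ^ 2 + Nat.card K + 1) * x := by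
  have h := sum_ncard_sep_eq_ncard_mul L (directionsIn (⊤ : Submodule K (Point K)))
    (fun l δ => l.direction = δ) 1 (fun l hl => ncard_setOf_eq_one
      ⟨l.direction, ⟨mem_directionsIn.2 ⟨(hL.1 l hl).2, le_top⟩, rfl⟩, fun δ h => h.2.symm⟩)
  rw [mul_one, Finset.sum_congr rfl fun δ hδ =>
    hL.ncard_direction_eq (mem_directionsIn.1 hδ).1, Finset.sum_const, card_directionsIn,
    finrank_top, Module.finrank_fin_fun] at h
  rw [← h, smul_eq_mul]
  congr 1
  simp only [Finset.sum_range_succ, Finset.sum_range_zero]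
  ring

/-- The switched spreads for `ε` and for `δ` agree outside `π`, so their traces on `L` inside `π`
have equal size. -/
theorem IsCLLineClass.ncard_direction_eq_le [Finite K] (hL : IsCLLineClass L x)
    {π : AffineSubspace K (Point K)} {δ ε : Submodule K (Point K)}
    (hδ : Module.finrank K δ = 1) (hδπ : δ ≤ π.direction)
    (hε : Module.finrank K ε = 1) (hεπ : ε ≤ π.direction) :
    {l | l ∈ linesIn π ∩ L ∧ l.direction = ε}.ncard =
      {l | l ∈ linesIn π ∩ L ∧ l.direction = δ}.ncard := by
  have key : ∀ ε : Submodule K (Point K), Module.finrank K ε = 1 → ε ≤ π.direction →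
      {l | l ∈ linesIn π ∩ L ∧ l.direction = ε}.ncard +
        {l | l ∈ L ∧ l.direction = δ ∧ ¬ l ≤ π}.ncard = x := by
    intro ε hε hεπ
    rw [← hL.2 _ (isLineSpread_switch hδ hδπ hε hεπ), ← Set.ncard_union_eq]
    · congr 1
      ext l
      have := hL.1 l
      simp only [linesIn, Set.mem_union, Set.mem_ofPred_eq, Set.mem_inter_iff]
      tauto
    · rw [Set.disjoint_left]
      rintro l ⟨⟨⟨_, h⟩, _⟩, _⟩ ⟨_, _, h'⟩
      exact h' h
  have h1 := key ε hε hεπ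
  have h2 := key δ hδ hδπ
  omega

theorem IsCLLineClass.dvd_ncard_linesIn [Finite K] (hL : IsCLLineClass L x)
    {π : AffineSubspace K (Point K)} (hπ : IsPlane π) :
    Nat.card K + 1 ∣ (linesIn π ∩ L).ncard := by
  have hc : (directionsIn π.direction).card = Nat.card K + 1 := by
    rw [card_directionsIn, hπ.2]
    simp [Finset.sum_range_succ, add_comm]
  obtain ⟨δ, hδ⟩ : (directionsIn π.direction).Nonempty := by
    rw [← Finset.card_pos]
    omega
  have h := sum_ncard_sep_eq_ncard_mul (linesIn π ∩ L) (directionsIn π.direction)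
    (fun l δ => l.direction = δ) 1 (fun l hl => ncard_setOf_eq_one
      ⟨l.direction, ⟨mem_directionsIn.2 ⟨hl.1.1.2, AffineSubspace.direction_le hl.1.2⟩, rfl⟩,
        fun δ h => h.2.symm⟩)
  rw [mem_directionsIn] at hδ
  rw [mul_one, Finset.sum_congr rfl fun ε hε => hL.ncard_direction_eq_le hδ.1 hδ.2
    (mem_directionsIn.1 hε).1 (mem_directionsIn.1 hε).2, Finset.sum_const, hc] at h
  exact ⟨_, h.symm⟩

/-! ### Regular spreads through the `z`-axis. -/

/-- Two lines are skew if they neither meet nor are parallel. -/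
def Skew (l m : AffineSubspace K (Point K)) : Prop :=
  Disjoint (l : Set (Point K)) (m : Set (Point K)) ∧ l.direction ≠ m.direction

/-- The map `t ↦ t² - t` identifies `0` and `1`, so on a finite field it misses some `n`. This gives
an anisotropic binary form in every characteristic, 2 included. -/
theorem exists_forall_sq_sub_ne [Finite K] :
    ∃ n : K, ∀ c d : K, c ^ 2 - c * d - n * d ^ 2 = 0 → c = 0 ∧ d = 0 := by
  have h : ¬ Function.Surjective fun t : K => t ^ 2 - t := by
    rw [← Finite.injective_iff_surjective]
    exact fun h => zero_ne_one (h (by simp : (0 : K) ^ 2 - 0 = 1 ^ 2 - 1))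
  rw [Function.Surjective] at h
  push Not at h
  obtain ⟨n, hn⟩ := h
  refine ⟨n, fun c d h => ?_⟩
  by_cases hd : d = 0
  · subst hd
    simpa using h
  · refine absurd ?_ (hn (c / d))
    field_simp
    linear_combination h

/-- The line `{cx + dy = 1, z = ax + by}`, where `v = (c, d) ≠ 0` and `w = (a, b)`. -/
def skewLine (v w : K × K) : AffineSubspace K (Point K) where
  carrier := {X | v.1 * X 0 + v.2 * X 1 = 1 ∧ X 2 = w.1 * X 0 + w.2 * X 1}
  smul_vsub_vadd_mem' t X Y Z := by
    rintro ⟨hX, hX'⟩ ⟨hY, hY'⟩ ⟨hZ, hZ'⟩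
    simp only [Set.mem_ofPred_eq, vsub_eq_sub, vadd_eq_add, Pi.add_apply, Pi.smul_apply,
      Pi.sub_apply, smul_eq_mul]
    constructor
    · linear_combination t * hX - t * hY + hZ
    · linear_combination t * hX' - t * hY' + hZ'

theorem mem_skewLine {v w : K × K} {X : Point K} :
    X ∈ skewLine v w ↔ v.1 * X 0 + v.2 * X 1 = 1 ∧ X 2 = w.1 * X 0 + w.2 * X 1 := Iff.rfl

theorem exists_pairing_eq_one {v : K × K} (hv : v ≠ 0) : ∃ s t : K, v.1 * s + v.2 * t = 1 := by
  by_cases h : v.1 = 0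
  · have h2 : v.2 ≠ 0 := fun h2 => hv (Prod.ext h h2)
    exact ⟨0, v.2⁻¹, by simp [h2]⟩
  · exact ⟨v.1⁻¹, 0, by simp [h]⟩

theorem skewLine_eq_mk' {v w : K × K} {s t : K} (h : v.1 * s + v.2 * t = 1) :
    skewLine v w = AffineSubspace.mk' ![s, t, w.1 * s + w.2 * t]
      (K ∙ (![v.2, -v.1, w.1 * v.2 - w.2 * v.1] : Point K)) := by
  ext X
  rw [mem_skewLine, AffineSubspace.mem_mk', Submodule.mem_span_singleton]
  constructor
  · rintro ⟨h1, h2⟩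
    refine ⟨t * X 0 - s * X 1, ?_⟩
    ext i
    fin_cases i
    · simp
      linear_combination X 0 * h - s * h1
    · simp
      linear_combination X 1 * h - t * h1
    · simp
      linear_combination (w.1 * X 0 + w.2 * X 1) * h - (w.1 * s + w.2 * t) * h1 - h2
  · rintro ⟨r, hr⟩
    have h0 := congrFun hr 0
    have h1 := congrFun hr 1
    have h2 := congrFun hr 2
    simp at h0 h1 h2
    constructor
    · linear_combination h - v.1 * h0 - v.2 * h1
    · linear_combination w.1 * h0 + w.2 * h1 - h2

theorem isLine_skewLine {v : K × K} (hv : v ≠ 0) (w : K × K) : IsLine (skewLine v w) := by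
  obtain ⟨s, t, h⟩ := exists_pairing_eq_one hv
  rw [skewLine_eq_mk' h]
  refine isLine_mk' _ (finrank_span_singleton fun h0 => hv ?_)
  have h1 := congrFun h0 0
  have h2 := congrFun h0 1
  simp at h1 h2
  exact Prod.ext h2 h1

theorem skewLine_injective {v v' w w' : K × K} (hv : v ≠ 0)
    (h : skewLine v w = skewLine v' w') : v = v' ∧ w = w' := by
  obtain ⟨s, t, hst⟩ := exists_pairing_eq_one hv
  have key : ∀ r : K, (![s + r * v.2, t - r * v.1,
      w.1 * (s + r * v.2) + w.2 * (t - r * v.1)] : Point K) ∈ skewLine v' w' := fun r => by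
    rw [← h, mem_skewLine]
    simp
    linear_combination hst
  have h0 := key 0
  have h1 := key 1
  simp only [mem_skewLine] at h0 h1
  simp at h0 h1
  obtain ⟨a0, b0⟩ := h0
  obtain ⟨a1, b1⟩ := h1
  have a2 : v'.1 * v.2 - v'.2 * v.1 = 0 := by linear_combination a1 - a0
  have b2 : (w.1 - w'.1) * v.2 - (w.2 - w'.2) * v.1 = 0 := by linear_combination b1 - b0
  refine ⟨Prod.ext ?_ ?_, Prod.ext ?_ ?_⟩
  · linear_combination v'.1 * hst - v.1 * a0 - t * a2
  · linear_combination v'.2 * hst - v.2 * a0 + s * a2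
  · linear_combination v.1 * b0 + t * b2 - (w.1 - w'.1) * hst
  · linear_combination v.2 * b0 - s * b2 - (w.2 - w'.2) * hst

/-- The line `{x = y = 0}`. -/
def zAxis : AffineSubspace K (Point K) := AffineSubspace.mk' 0 (K ∙ (![0, 0, 1] : Point K))

theorem mem_zAxis {X : Point K} : X ∈ (zAxis : AffineSubspace K (Point K)) ↔ X 0 = 0 ∧ X 1 = 0 := by
  rw [zAxis, AffineSubspace.mem_mk', Submodule.mem_span_singleton]
  constructor
  · rintro ⟨r, hr⟩
    have h0 := congrFun hr 0
    have h1 := congrFun hr 1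
    simp at h0 h1
    exact ⟨h0.symm, h1.symm⟩
  · rintro ⟨h0, h1⟩
    refine ⟨X 2, ?_⟩
    ext i
    fin_cases i <;> simp [h0, h1]

theorem isLine_zAxis : IsLine (zAxis : AffineSubspace K (Point K)) :=
  isLine_mk' 0 (finrank_span_singleton fun h => one_ne_zero (congrFun h 2))

theorem skew_zAxis_skewLine {v : K × K} (hv : v ≠ 0) (w : K × K) : Skew zAxis (skewLine v w) := by
  constructor
  · rw [Set.disjoint_left]
    intro X hX hX'
    rw [SetLike.mem_coe, mem_zAxis] at hX
    rw [SetLike.mem_coe, mem_skewLine, hX.1, hX.2] at hX'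
    simp at hX'
  · obtain ⟨s, t, h⟩ := exists_pairing_eq_one hv
    rw [skewLine_eq_mk' h, zAxis, AffineSubspace.direction_mk', AffineSubspace.direction_mk']
    intro h
    have := h ▸ Submodule.mem_span_singleton_self (R := K)
      (![v.2, -v.1, w.1 * v.2 - w.2 * v.1] : Point K)
    rw [Submodule.mem_span_singleton] at this
    obtain ⟨r, hr⟩ := this
    have h0 := congrFun hr 0
    have h1 := congrFun hr 1
    simp at h0 h1
    exact hv (Prod.ext h1 h0.symm)

/-- Projected along the `z`-axis, `m` becomes a line missing the origin, hence `cx + dy = 1`; the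
plane joining `m` to the origin is `z = ax + by`. -/
theorem exists_eq_skewLine {m : AffineSubspace K (Point K)} (hm : IsLine m) (h : Skew zAxis m) :
    ∃ v w : K × K, v ≠ 0 ∧ m = skewLine v w := by
  obtain ⟨⟨p, hp⟩, hd⟩ := hm
  obtain ⟨⟨u, hu⟩, hu0, hspan⟩ := finrank_eq_one_iff'.1 hd
  have hdir : m.direction = K ∙ u := by
    refine le_antisymm (fun y hy => ?_) ((Submodule.span_singleton_le_iff_mem _ _).2 hu)
    obtain ⟨c, hc⟩ := hspan ⟨y, hy⟩
    exact Submodule.mem_span_singleton.2 ⟨c, congrArg Subtype.val hc⟩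
  have hmk : m = AffineSubspace.mk' p (K ∙ u) := hdir ▸ (AffineSubspace.mk'_eq hp).symm
  have hmem : ∀ r : K, p + r • u ∈ m := fun r => by
    rw [hmk, AffineSubspace.mem_mk', Submodule.mem_span_singleton]
    exact ⟨r, by simp⟩
  have hu01 : ¬ (u 0 = 0 ∧ u 1 = 0) := by
    rintro ⟨h0, h1⟩
    have h2 : u 2 ≠ 0 := fun h2 => hu0 (by
      ext i
      fin_cases i <;> simp [h0, h1, h2])
    apply h.2
    rw [hdir, zAxis, AffineSubspace.direction_mk',
      ← Submodule.span_singleton_smul_eq (IsUnit.mk0 _ h2) (![0, 0, 1] : Point K)]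
    congr 2
    ext i
    fin_cases i <;> simp [h0, h1]
  have hmeet : ∀ r : K, ¬ (p 0 + r * u 0 = 0 ∧ p 1 + r * u 1 = 0) := fun r hr =>
    Set.disjoint_left.1 h.1 (mem_zAxis.2 hr) (hmem r)
  -- `D` vanishes only if the projection of `m` passes through the origin. The coefficients below
  -- are Cramer's solution of `v·u = 0`, `v·p = 1`, `w·u = u 2`, `w·p = p 2`.
  have hD : u 0 * p 1 - u 1 * p 0 ≠ 0 := by
    intro hD
    by_cases h0 : u 0 = 0
    · have h1 : u 1 ≠ 0 := fun h1 => hu01 ⟨h0, h1⟩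
      have hp0 : p 0 = 0 := by simpa [h0, h1] using hD
      exact hmeet (-p 1 / u 1) ⟨by simp [h0, hp0], by field_simp; ring⟩
    · refine hmeet (-p 0 / u 0) ⟨by field_simp; ring, ?_⟩
      field_simp
      linear_combination hD
  set D := u 0 * p 1 - u 1 * p 0 with hDdef
  have hv : ((-u 1 / D, u 0 / D) : K × K) ≠ 0 := by
    intro h
    have h1 := congrArg Prod.fst h
    have h2 := congrArg Prod.snd h
    simp [hD] at h1 h2
    exact hu01 ⟨h2, h1⟩
  refine ⟨(-u 1 / D, u 0 / D), ((u 2 * p 1 - p 2 * u 1) / D, (u 0 * p 2 - p 0 * u 2) / D), hv, ?_⟩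
  have hle : m ≤ skewLine (-u 1 / D, u 0 / D)
      ((u 2 * p 1 - p 2 * u 1) / D, (u 0 * p 2 - p 0 * u 2) / D) := by
    intro X hX
    rw [hmk, AffineSubspace.mem_mk', Submodule.mem_span_singleton] at hX
    obtain ⟨r, hr⟩ := hX
    have hX : X = p + r • u := by rw [hr]; simp
    rw [mem_skewLine, hX]
    simp only [Pi.add_apply, Pi.smul_apply, smul_eq_mul]
    constructor
    · field_simp
      rw [hDdef]
      ring
    · field_simp
      rw [hDdef]
      ring
  refine eq_of_direction_eq_of_mem ?_ hp (hle hp)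
  exact Submodule.eq_of_le_of_finrank_eq (AffineSubspace.direction_le hle)
    (by rw [hd, (isLine_skewLine hv _).2])

/-- The affine part of a regular spread containing the `z`-axis. -/
def regularSpread (n : K) (b : K × K) : Set (AffineSubspace K (Point K)) :=
  insert zAxis {m | ∃ v : K × K, v ≠ 0 ∧ m = skewLine v (n * v.2 + b.1, v.1 - v.2 + b.2)}

/-- The lines are `skewLine v (A v + b)` with `A v = (n v₂, v₁ - v₂)`. A point off the `z`-axis
imposes two linear equations on `v`, whose determinant is nonzero because the form of `hn` is
anisotropic. -/
theorem isLineSpread_regularSpread {n : K}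
    (hn : ∀ c d : K, c ^ 2 - c * d - n * d ^ 2 = 0 → c = 0 ∧ d = 0) (b : K × K) :
    IsLineSpread (regularSpread n b) := by
  have hz : ∀ (X : Point K) (v w : K × K), v ≠ 0 → X ∈ (zAxis : AffineSubspace K (Point K)) →
      X ∉ skewLine v w := fun X v w hv hX hX' =>
    Set.disjoint_left.1 (skew_zAxis_skewLine hv w).1 hX hX'
  have hdet : ∀ X : Point K, ¬ (X 0 = 0 ∧ X 1 = 0) →
      X 0 * (n * X 0 - X 1) - X 1 ^ 2 ≠ 0 := by
    intro X hX h
    have := hn (-X 1) (X 0) (by linear_combination -h)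
    exact hX ⟨this.2, by simpa using this.1⟩
  refine isLineSpread_of_existsUnique ?_ (fun X => ?_) ?_
  · rintro l (rfl | ⟨v, hv, rfl⟩)
    · exact isLine_zAxis
    · exact isLine_skewLine hv _
  · by_cases hX : X 0 = 0 ∧ X 1 = 0
    · exact ⟨zAxis, Or.inl rfl, mem_zAxis.2 hX⟩
    · have hD := hdet X hX
      -- Cramer's rule for `v·(X 0, X 1) = 1` and `(A v)·(X 0, X 1) = k`.
      set D := X 0 * (n * X 0 - X 1) - X 1 ^ 2 with hDdef
      set k := X 2 - b.1 * X 0 - b.2 * X 1 with hk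
      have h1 : (n * X 0 - X 1 - X 1 * k) / D * X 0 + (X 0 * k - X 1) / D * X 1 = 1 := by
        field_simp
        rw [hDdef]
        ring
      refine ⟨skewLine ((n * X 0 - X 1 - X 1 * k) / D, (X 0 * k - X 1) / D) _,
        Or.inr ⟨_, fun h => ?_, rfl⟩, mem_skewLine.2 ⟨h1, ?_⟩⟩
      · have h2 := congrArg Prod.fst h
        have h3 := congrArg Prod.snd h
        simp only [Prod.fst_zero, Prod.snd_zero] at h2 h3
        rw [h2, h3] at h1
        simp at h1
      · have h4 : X 2 = k + b.1 * X 0 + b.2 * X 1 := by rw [hk]; ring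
        rw [h4]
        field_simp
        rw [hDdef]
        ring
  · rintro X l hl m hm hXl hXm
    rcases hl with rfl | ⟨v, hv, rfl⟩ <;> rcases hm with rfl | ⟨v', hv', rfl⟩
    · rfl
    · exact absurd hXm (hz _ _ _ hv' hXl)
    · exact absurd hXl (hz _ _ _ hv hXm)
    · have hX : ¬ (X 0 = 0 ∧ X 1 = 0) := fun h => hz _ _ _ hv (mem_zAxis.2 h) hXl
      have hD := hdet X hX
      obtain ⟨a1, a2⟩ := mem_skewLine.1 hXl
      obtain ⟨b1, b2⟩ := mem_skewLine.1 hXm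
      simp only at a2 b2
      have e1 : v.1 = v'.1 := by
        refine mul_right_cancel₀ hD ?_
        linear_combination (n * X 0 - X 1) * (a1 - b1) - X 1 * (b2 - a2)
      have e2 : v.2 = v'.2 := by
        refine mul_right_cancel₀ hD ?_
        linear_combination -X 1 * (a1 - b1) + X 0 * (b2 - a2)
      rw [Prod.ext e1 e2]

/-- Each of the `q²` regular spreads, one for each `b`, meets `L` in `x` lines, and a line skew to
the axis lies in exactly one of them. The second term is `q²` or `0`, as the axis is in `L` or not.
-/
theorem IsCLLineClass.ncard_skew_zAxis [Finite K] (hL : IsCLLineClass L x) :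
    {m | m ∈ L ∧ Skew zAxis m}.ncard + Nat.card K ^ 2 * {m | m ∈ L ∧ m = zAxis}.ncard =
      Nat.card K ^ 2 * x := by
  classical
  have := Fintype.ofFinite K
  obtain ⟨n, hn⟩ := exists_forall_sq_sub_ne (K := K)
  have h := sum_ncard_sep_eq_ncard_mul {m | m ∈ L ∧ Skew zAxis m} (Finset.univ : Finset (K × K))
    (fun m b => m ∈ regularSpread n b) 1 (fun m hm => ncard_setOf_eq_one ?_)
  · have hb : ∀ b ∈ (Finset.univ : Finset (K × K)),
        {m | m ∈ {m | m ∈ L ∧ Skew zAxis m} ∧ m ∈ regularSpread n b}.ncard +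
          {m | m ∈ L ∧ m = zAxis}.ncard = x := by
      intro b _
      rw [← hL.2 _ (isLineSpread_regularSpread hn b), ← Set.ncard_union_eq]
      · congr 1
        ext m
        simp only [Set.mem_union, Set.mem_ofPred_eq, Set.mem_inter_iff]
        constructor
        · rintro (⟨⟨h1, -⟩, h3⟩ | ⟨h1, rfl⟩)
          · exact ⟨h1, h3⟩
          · exact ⟨h1, Or.inl rfl⟩
        · rintro ⟨h1, h2⟩
          rcases h2 with rfl | ⟨v, hv, rfl⟩
          · exact Or.inr ⟨h1, rfl⟩
          · exact Or.inl ⟨⟨h1, skew_zAxis_skewLine hv _⟩, Or.inr ⟨v, hv, rfl⟩⟩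
      · rw [Set.disjoint_left]
        rintro m ⟨⟨_, h⟩, _⟩ ⟨_, rfl⟩
        exact h.2 rfl
    have hs := Finset.sum_congr rfl hb
    rw [Finset.sum_add_distrib, h, mul_one, Finset.sum_const, Finset.sum_const,
      Finset.card_univ, Fintype.card_prod, Fintype.card_eq_nat_card, smul_eq_mul, smul_eq_mul,
      ← sq] at hs
    exact hs
  · obtain ⟨v, w, hv, rfl⟩ := exists_eq_skewLine (hL.1 m hm.1) hm.2
    -- The only possible shift is `b = w - A v`.
    refine ⟨(w.1 - n * v.2, w.2 - v.1 + v.2), ⟨Finset.mem_univ _, Or.inr ⟨v, hv, ?_⟩⟩, ?_⟩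
    · congr 1
      ext <;> simp
    · rintro b ⟨_, hb | ⟨v', hv', hb⟩⟩
      · exact absurd (congrArg _ hb).symm hm.2.2
      · obtain ⟨rfl, rfl⟩ := skewLine_injective hv hb
        ext
        · simp
        · simp only
          ring

/-! ### Transport by affine automorphisms. -/

/-- The image of an affine subspace under an affine automorphism. -/
def image (T : Point K ≃ᵃ[K] Point K) (l : AffineSubspace K (Point K)) :
    AffineSubspace K (Point K) := l.map T.toAffineMap

theorem coe_image (T : Point K ≃ᵃ[K] Point K) (l : AffineSubspace K (Point K)) :
    (image T l : Set (Point K)) = T '' l := rfl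

theorem direction_image (T : Point K ≃ᵃ[K] Point K) (l : AffineSubspace K (Point K)) :
    (image T l).direction = l.direction.map T.linear.toLinearMap :=
  AffineSubspace.map_direction _ _

theorem image_injective (T : Point K ≃ᵃ[K] Point K) : Function.Injective (image T) := by
  intro l m h
  apply SetLike.coe_injective
  apply T.injective.image_injective
  rw [← coe_image, h, coe_image]

theorem image_surjective (T : Point K ≃ᵃ[K] Point K) : Function.Surjective (image T) := by
  refine fun l => ⟨image T.symm l, SetLike.coe_injective ?_⟩
  rw [coe_image, coe_image, ← Set.image_comp]
  simp

theorem isLine_image_iff (T : Point K ≃ᵃ[K] Point K) {l : AffineSubspace K (Point K)} :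
    IsLine (image T l) ↔ IsLine l := by
  rw [IsLine, IsLine, coe_image, Set.image_nonempty, direction_image,
    LinearEquiv.finrank_map_eq]

theorem skew_image_iff (T : Point K ≃ᵃ[K] Point K) {l m : AffineSubspace K (Point K)} :
    Skew (image T l) (image T m) ↔ Skew l m := by
  rw [Skew, Skew, coe_image, coe_image, Set.disjoint_image_iff T.injective, direction_image,
    direction_image, (Submodule.map_injective_of_injective T.linear.injective).ne_iff]

theorem IsLineSpread.image {S : Set (AffineSubspace K (Point K))} (hS : IsLineSpread S)
    (T : Point K ≃ᵃ[K] Point K) : IsLineSpread (image T '' S) := by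
  refine ⟨⟨?_, ?_⟩, fun p => ?_⟩
  · rintro _ ⟨l, hl, rfl⟩
    exact (isLine_image_iff T).2 (hS.1.1 l hl)
  · rintro _ ⟨l, hl, rfl⟩ _ ⟨m, hm, rfl⟩ hne
    rw [coe_image, coe_image, Set.disjoint_image_iff T.injective]
    exact hS.1.2 l hl m hm fun h => hne (h ▸ rfl)
  · obtain ⟨l, hl, hp⟩ := hS.2 (T.symm p)
    exact ⟨_, ⟨l, hl, rfl⟩, T.symm p, hp, T.apply_symm_apply p⟩

theorem IsCLLineClass.preimage (hL : IsCLLineClass L x) (T : Point K ≃ᵃ[K] Point K) :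
    IsCLLineClass (image T ⁻¹' L) x := by
  refine ⟨fun l hl => (isLine_image_iff T).1 (hL.1 _ hl), fun S hS => ?_⟩
  rw [← hL.2 _ (hS.image T), ← Set.ncard_image_of_injective _ (image_injective T),
    Set.image_preimage_inter]

theorem exists_image_zAxis_eq {l : AffineSubspace K (Point K)} (hl : IsLine l) :
    ∃ T : Point K ≃ᵃ[K] Point K, image T zAxis = l := by
  obtain ⟨⟨p, hp⟩, hd⟩ := hl
  obtain ⟨g, hg⟩ := Submodule.exists_linearEquiv_restrict_eq
    (LinearEquiv.ofFinrankEq (zAxis : AffineSubspace K (Point K)).direction l.direction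
      (isLine_zAxis.2.trans hd.symm))
  refine ⟨g.toAffineEquiv.trans (AffineEquiv.constVAdd K (Point K) p), ?_⟩
  refine eq_of_direction_eq_of_mem (p := p) ?_ ⟨0, mem_zAxis.2 ⟨rfl, rfl⟩, by simp⟩ hp
  rw [direction_image]
  refine Submodule.eq_of_le_of_finrank_eq ?_ ?_
  · rintro _ ⟨y, hy, rfl⟩
    have := hg ⟨y, hy⟩
    simp only at this
    change g y ∈ l.direction
    rw [← this]
    exact Subtype.coe_prop _
  · rw [LinearEquiv.finrank_map_eq, isLine_zAxis.2, hd]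

theorem IsCLLineClass.ncard_skew [Finite K] (hL : IsCLLineClass L x)
    {l : AffineSubspace K (Point K)} (hl : IsLine l) :
    {m | m ∈ L ∧ Skew l m}.ncard + Nat.card K ^ 2 * {m | m ∈ L ∧ m = l}.ncard =
      Nat.card K ^ 2 * x := by
  obtain ⟨T, rfl⟩ := exists_image_zAxis_eq hl
  rw [← (hL.preimage T).ncard_skew_zAxis,
    ← Set.ncard_preimage_of_injective_subset_range (image_injective T)
      (by simp [(image_surjective T).range_eq]),
    ← Set.ncard_preimage_of_injective_subset_range (s := {m | m ∈ L ∧ m = _}) (image_injective T)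
      (by simp [(image_surjective T).range_eq])]
  simp only [Set.preimage_ofPred_eq, skew_image_iff, Set.mem_preimage, (image_injective T).eq_iff]

/-! ### Skewness to the lines of a pencil. -/

/-- The lines through `p` skew to the line `m` are those outside the plane `⟨p, m⟩`. -/
theorem skew_mk'_iff {p r : Point K} {m : AffineSubspace K (Point K)} (hm : IsLine m)
    (hr : r ∈ m) (hp : p ∉ m) {δ : Submodule K (Point K)} (hδ : Module.finrank K δ = 1) :
    Skew (AffineSubspace.mk' p δ) m ↔ ¬ δ ≤ m.direction ⊔ K ∙ (r - p) := by
  rw [Skew, AffineSubspace.direction_mk', Set.disjoint_left]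
  constructor
  · rintro ⟨h1, h2⟩ hle
    obtain ⟨⟨d, hd⟩, hd0, hspan⟩ := finrank_eq_one_iff'.1 hδ
    obtain ⟨w, hw, y, hy, hwy⟩ := Submodule.mem_sup.1 (hle hd)
    obtain ⟨c, rfl⟩ := Submodule.mem_span_singleton.1 hy
    -- If `c = 0` the lines are parallel; otherwise they meet at `p + c⁻¹ • d`.
    by_cases hc : c = 0
    · refine h2 (Submodule.eq_of_le_of_finrank_eq (fun z hz => ?_) (hδ.trans hm.2.symm))
      obtain ⟨k, hk⟩ := hspan ⟨z, hz⟩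
      have hk : k • d = z := congrArg Subtype.val hk
      rw [← hk, ← hwy, hc, zero_smul, add_zero]
      exact m.direction.smul_mem k hw
    · refine h1 (a := p + c⁻¹ • d) ?_ ?_
      · rw [SetLike.mem_coe, AffineSubspace.mem_mk']
        simpa using δ.smul_mem c⁻¹ hd
      · have : p + c⁻¹ • d = c⁻¹ • w +ᵥ r := by
          rw [← hwy, smul_add, smul_smul, inv_mul_cancel₀ hc, vadd_eq_add]
          module
        rw [SetLike.mem_coe, this]
        exact AffineSubspace.vadd_mem_of_mem_direction (m.direction.smul_mem _ hw) hr
  · intro hle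
    refine ⟨fun X hX hXm => hle ?_, fun h => hle (h ▸ le_sup_left)⟩
    rw [SetLike.mem_coe, AffineSubspace.mem_mk', vsub_eq_sub] at hX
    have hne : (⟨X - p, hX⟩ : δ) ≠ 0 := fun h => hp (by
      have h := sub_eq_zero.1 (congrArg Subtype.val h)
      exact h ▸ hXm)
    have hXU : X - p ∈ m.direction ⊔ K ∙ (r - p) := by
      rw [← sub_add_sub_cancel X r p]
      exact Submodule.add_mem_sup (AffineSubspace.vsub_mem_direction hXm hr)
        (Submodule.mem_span_singleton_self _)
    intro z hz
    obtain ⟨k, hk⟩ := (finrank_eq_one_iff_of_nonzero' _ hne).1 hδ ⟨z, hz⟩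
    have hk : k • (X - p) = z := congrArg Subtype.val hk
    exact hk ▸ Submodule.smul_mem _ k hXU

theorem finrank_join {p r : Point K} {m : AffineSubspace K (Point K)} (hm : IsLine m)
    (hr : r ∈ m) (hp : p ∉ m) :
    Module.finrank K ↥(m.direction ⊔ K ∙ (r - p)) = 2 := by
  have hrp : r - p ∉ m.direction := fun h => hp (by
    rw [← AffineSubspace.mk'_eq hr, AffineSubspace.mem_mk', vsub_eq_sub, ← neg_sub]
    exact neg_mem h)
  have h0 : r - p ≠ 0 := fun h => hrp (h ▸ zero_mem _)
  have h := Submodule.finrank_sup_add_finrank_inf_eq m.direction (K ∙ (r - p))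
  rw [((Submodule.disjoint_span_singleton' h0).2 hrp).eq_bot, finrank_bot, hm.2,
    finrank_span_singleton h0] at h
  exact h

theorem le_mk'_iff {p r : Point K} {m : AffineSubspace K (Point K)} (hr : r ∈ m)
    {W : Submodule K (Point K)} :
    m ≤ AffineSubspace.mk' p W ↔ m.direction ⊔ K ∙ (r - p) ≤ W := by
  rw [sup_le_iff, Submodule.span_singleton_le_iff_mem]
  constructor
  · intro h
    refine ⟨?_, AffineSubspace.mem_mk'.1 (h hr)⟩
    rw [← AffineSubspace.direction_mk' p W]
    exact AffineSubspace.direction_le h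
  · rintro ⟨h1, h2⟩ X hX
    rw [AffineSubspace.mem_mk', vsub_eq_sub, ← sub_add_sub_cancel X r p]
    exact W.add_mem (h1 (AffineSubspace.vsub_mem_direction hX hr)) h2

/-- A line neither passing through `p` nor lying in the plane `p + W` is skew to exactly `q`
of the `q + 1` lines of the pencil determined by `p` and `W`. -/
theorem ncard_skew_pencil [Finite K] {W : Submodule K (Point K)} (hW : Module.finrank K W = 2)
    {p : Point K} {m : AffineSubspace K (Point K)} (hm : IsLine m) (hp : p ∉ m)
    (hmW : ¬ m ≤ AffineSubspace.mk' p W) :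
    {δ | δ ∈ directionsIn W ∧ Skew (AffineSubspace.mk' p δ) m}.ncard = Nat.card K := by
  obtain ⟨r, hr⟩ := hm.1
  set U : Submodule K (Point K) := m.direction ⊔ K ∙ (r - p) with hU
  have hU2 : Module.finrank K U = 2 := finrank_join hm hr hp
  -- `W` and `U` are distinct planes of a 3-space, so just one line of the pencil lies in the plane
  -- `⟨p, m⟩` and fails to be skew to `m`.
  have hinf : Module.finrank K ↥(W ⊓ U) = 1 := by
    have h1 := Submodule.finrank_sup_add_finrank_inf_eq W U
    have h2 := Submodule.finrank_le (W ⊔ U)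
    have h3 := Submodule.finrank_mono (inf_le_left : W ⊓ U ≤ W)
    rw [Module.finrank_fin_fun] at h2
    have h4 : Module.finrank K ↥(W ⊓ U) ≠ 2 := fun h => by
      have e1 := Submodule.eq_of_le_of_finrank_eq (inf_le_right : W ⊓ U ≤ U) (h.trans hU2.symm)
      exact hmW ((le_mk'_iff hr).2 (inf_eq_right.1 e1))
    rw [hW, hU2] at h1
    rw [hW] at h3
    omega
  have h1 := ncard_sep_add_ncard_sep_not (directionsIn W : Set (Submodule K (Point K))) (· ≤ U)
  have h2 : {δ | δ ∈ (directionsIn W : Set (Submodule K (Point K))) ∧ δ ≤ U} =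
      (directionsIn (W ⊓ U) : Set (Submodule K (Point K))) := by
    ext δ
    simp only [Set.mem_ofPred_eq, Finset.mem_coe, mem_directionsIn, le_inf_iff, and_assoc]
  have h3 : {δ | δ ∈ directionsIn W ∧ Skew (AffineSubspace.mk' p δ) m} =
      {δ | δ ∈ (directionsIn W : Set (Submodule K (Point K))) ∧ ¬ δ ≤ U} := by
    ext δ
    simp only [Set.mem_ofPred_eq, Finset.mem_coe]
    exact and_congr_right fun h => skew_mk'_iff hm hr hp (mem_directionsIn.1 h).1
  rw [h2, Set.ncard_coe_finset, Set.ncard_coe_finset, card_directionsIn, card_directionsIn, hW,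
    hinf, ← h3] at h1
  simp [Finset.sum_range_succ] at h1
  omega

theorem Skew.notMem_and_not_le {W : Submodule K (Point K)} (hW : Module.finrank K W = 2)
    {p : Point K} {m : AffineSubspace K (Point K)} (hm : IsLine m) {δ : Submodule K (Point K)}
    (hδ : Module.finrank K δ = 1) (hδW : δ ≤ W) (h : Skew (AffineSubspace.mk' p δ) m) :
    p ∉ m ∧ ¬ m ≤ AffineSubspace.mk' p W := by
  have hp : p ∉ m := Set.disjoint_left.1 h.1 (AffineSubspace.self_mem_mk' p δ)
  obtain ⟨r, hr⟩ := hm.1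
  refine ⟨hp, fun hle => (skew_mk'_iff hm hr hp hδ).1 h ?_⟩
  rwa [Submodule.eq_of_le_of_finrank_eq ((le_mk'_iff hr).1 hle)
    ((finrank_join hm hr hp).trans hW.symm)]

theorem sum_ncard_eq_pencil [Finite K] (hL : ∀ l ∈ L, IsLine l) (p : Point K)
    (W : Submodule K (Point K)) :
    ∑ δ ∈ directionsIn W, {m | m ∈ L ∧ m = AffineSubspace.mk' p δ}.ncard =
      {m | m ∈ L ∧ p ∈ m ∧ m ≤ AffineSubspace.mk' p W}.ncard := by
  have h := sum_ncard_sep_eq_ncard_mul {m | m ∈ L ∧ p ∈ m ∧ m ≤ AffineSubspace.mk' p W}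
    (directionsIn W) (fun m δ => m = AffineSubspace.mk' p δ) 1
    (fun m hm => ncard_setOf_eq_one ⟨m.direction, ⟨mem_directionsIn.2 ⟨(hL m hm.1).2, ?_⟩,
      (AffineSubspace.mk'_eq hm.2.1).symm⟩, fun δ h => ?_⟩)
  · rw [← mul_one (Set.ncard _), ← h]
    refine Finset.sum_congr rfl fun δ hδ => ?_
    congr 1
    ext m
    refine ⟨?_, fun h => ⟨h.1.1, h.2⟩⟩
    rintro ⟨h1, rfl⟩
    refine ⟨⟨h1, AffineSubspace.self_mem_mk' p δ, fun X hX => ?_⟩, rfl⟩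
    rw [AffineSubspace.mem_mk'] at hX ⊢
    exact (mem_directionsIn.1 hδ).2 hX
  · rw [← AffineSubspace.direction_mk' p W]
    exact AffineSubspace.direction_le hm.2.2
  · rw [h.2, AffineSubspace.direction_mk']

/-- This is `ncard_skew` summed over the pencil, with a common factor `q` cancelled. -/
theorem IsCLLineClass.pencil_identity [Finite K] (hL : IsCLLineClass L x) (p : Point K)
    {W : Submodule K (Point K)} (hW : Module.finrank K W = 2) :
    {m | m ∈ L ∧ p ∉ m ∧ ¬ m ≤ AffineSubspace.mk' p W}.ncard +
      Nat.card K * {m | m ∈ L ∧ p ∈ m ∧ m ≤ AffineSubspace.mk' p W}.ncard =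
      (Nat.card K + 1) * (Nat.card K * x) := by
  have hs := Finset.sum_congr rfl fun δ (hδ : δ ∈ directionsIn W) =>
    hL.ncard_skew (isLine_mk' p (mem_directionsIn.1 hδ).1)
  have h := sum_ncard_sep_eq_ncard_mul {m | m ∈ L ∧ p ∉ m ∧ ¬ m ≤ AffineSubspace.mk' p W}
    (directionsIn W) (fun m δ => Skew (AffineSubspace.mk' p δ) m) (Nat.card K)
    (fun m hm => ncard_skew_pencil hW (hL.1 m hm.1) hm.2.1 hm.2.2)
  have h' : ∑ δ ∈ directionsIn W, {m | m ∈ L ∧ Skew (AffineSubspace.mk' p δ) m}.ncard =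
      {m | m ∈ L ∧ p ∉ m ∧ ¬ m ≤ AffineSubspace.mk' p W}.ncard * Nat.card K := by
    rw [← h]
    refine Finset.sum_congr rfl fun δ hδ => ?_
    congr 1
    ext m
    refine ⟨fun hm => ⟨⟨hm.1, ?_⟩, hm.2⟩, fun hm => ⟨hm.1.1, hm.2⟩⟩
    exact hm.2.notMem_and_not_le hW (hL.1 m hm.1) (mem_directionsIn.1 hδ).1
      (mem_directionsIn.1 hδ).2
  rw [Finset.sum_add_distrib, ← Finset.mul_sum, sum_ncard_eq_pencil hL.1, h', Finset.sum_const,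
    card_directionsIn, hW, smul_eq_mul] at hs
  simp only [Finset.sum_range_succ, Finset.sum_range_zero, pow_zero, pow_one, zero_add] at hs
  refine Nat.eq_of_mul_eq_mul_left (Nat.card_pos (α := K)) ?_
  linear_combination hs

theorem exists_finrank_eq_two : ∃ W : Submodule K (Point K), Module.finrank K W = 2 := by
  refine ⟨LinearMap.ker (LinearMap.proj 0 : Point K →ₗ[K] K), ?_⟩
  have h := LinearMap.finrank_range_add_finrank_ker (LinearMap.proj 0 : Point K →ₗ[K] K)
  rw [LinearMap.range_eq_top.2 (LinearMap.proj_surjective 0), finrank_top, Module.finrank_self,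
    Module.finrank_fin_fun] at h
  exact Nat.add_left_cancel (h : 1 + _ = 1 + 2)

/-! ### The congruence at a point. -/

theorem IsCLLineClass.ncard_linesThrough_modEq [Finite K] (hL : IsCLLineClass L x) (p : Point K) :
    (linesThrough p ∩ L).ncard ≡ x [MOD Nat.card K + 1] := by
  obtain ⟨W, hW⟩ := exists_finrank_eq_two (K := K)
  set π := AffineSubspace.mk' p W with hπ
  obtain ⟨c, hc⟩ := hL.dvd_ncard_linesIn (π := π)
    ⟨⟨p, AffineSubspace.self_mem_mk' p W⟩, by rw [hπ, AffineSubspace.direction_mk', hW]⟩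
  have hpen := hL.pencil_identity p hW
  have htot := hL.ncard_eq
  have h1 : linesThrough p ∩ L = {m | m ∈ L ∧ p ∈ m} := by
    ext m
    exact ⟨fun h => ⟨h.2, h.1.2⟩, fun h => ⟨⟨hL.1 m h.1, h.2⟩, h.1⟩⟩
  have h2 : linesIn π ∩ L = {m | m ∈ L ∧ m ≤ π} := by
    ext m
    exact ⟨fun h => ⟨h.2, h.1.2⟩, fun h => ⟨⟨hL.1 m h.1, h.2⟩, h.1⟩⟩
  have e1 := ncard_sep_add_ncard_sep_not L (p ∈ ·)
  have e3 := ncard_sep_add_ncard_sep_not {m | m ∈ L ∧ p ∉ m} (· ≤ π)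
  have e4 := ncard_sep_add_ncard_sep_not {m | m ∈ L ∧ m ≤ π} (p ∈ ·)
  have e5 : {m | m ∈ {m | m ∈ L ∧ m ≤ π} ∧ p ∈ m} = {m | m ∈ L ∧ p ∈ m ∧ m ≤ π} := by
    ext m
    simp only [Set.mem_ofPred_eq]
    tauto
  have e6 : {m | m ∈ {m | m ∈ L ∧ m ≤ π} ∧ p ∉ m} = {m | m ∈ {m | m ∈ L ∧ p ∉ m} ∧ m ≤ π} := by
    ext m
    simp only [Set.mem_ofPred_eq]
    tauto
  have e7 : {m | m ∈ {m | m ∈ L ∧ p ∉ m} ∧ ¬ m ≤ π} = {m | m ∈ L ∧ p ∉ m ∧ ¬ m ≤ π} := by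
    ext m
    simp only [Set.mem_ofPred_eq]
    tauto
  rw [e5, e6] at e4
  rw [e7] at e3
  rw [h2] at hc
  rw [h1]
  clear e5 e6 e7 h1 h2
  generalize {m | m ∈ L ∧ p ∈ m}.ncard = s at *
  generalize {m | m ∈ L ∧ p ∉ m}.ncard = s' at *
  generalize {m | m ∈ L ∧ p ∈ m ∧ m ≤ π}.ncard = a at *
  generalize {m | m ∈ L ∧ p ∉ m ∧ ¬ m ≤ π}.ncard = N at *
  generalize {m | m ∈ L ∧ m ≤ π}.ncard = t at *
  generalize {m | m ∈ {m | m ∈ L ∧ p ∉ m} ∧ m ≤ π}.ncard = u at *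
  generalize L.ncard = M at *
  rw [← Int.natCast_modEq_iff, Int.modEq_comm, Int.modEq_iff_dvd]
  zify at *
  -- From `s = x + (q + 1) a - t` and `t = (q + 1) c`; taken over the integers, since `a - c` may be
  -- negative.
  refine ⟨a - c, ?_⟩
  linear_combination e1 + htot - hpen + e3 - e4 - hc

end CameronLiebler

theorem lemma4p4 {K : Type*} [Field K] [Finite K]
    (L : Set (AffineSubspace K (CameronLiebler.Point K))) (x : ℕ)
    (hL : CameronLiebler.IsCLLineClass L x) :
    (∀ π : AffineSubspace K (CameronLiebler.Point K), CameronLiebler.IsPlane π →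
        (CameronLiebler.linesIn π ∩ L).ncard ≡ 0 [MOD Nat.card K + 1]) ∧
      (∀ p : CameronLiebler.Point K,
        (CameronLiebler.linesThrough p ∩ L).ncard ≡ x [MOD Nat.card K + 1]) :=
  ⟨fun _ hπ => Nat.modEq_zero_iff_dvd.2 (hL.dvd_ncard_linesIn hπ),
    fun p => hL.ncard_linesThrough_modEq p⟩
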